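/- Let $\mathcal A$ be a commutative (not necessarily unital) $C^*$-algebra and let $\widehat{\mathcal A}$ be its spectrum, that is, the space of characters (non-zero continuous multiplicative linear functionals) of $\mathcal A$ with the weak-$*$ topology, so that $\mathcal A\cong C_0(\widehat{\mathcal A})$. Suppose that $\widehat{\mathcal A}$ satisfies the Suslin condition: its Suslin number, i.e. the smallest cardinal $m\ge\aleph_0$ such that every family of non-empty, open, pairwise disjoint subsets of $\widehat{\mathcal A}$ has cardinality at most $m$, equals $\aleph_0$. Then the following conditions are equivalent: (i) $\mathcal A$ is left projective, i.e. projective in the category of left Banach $\mathcal A$-modules: for every left Banach $\mathcal A$-module $Y$ and every morphism of left Banach $\mathcal A$-modules $\varphi:Y\to\mathcal A$ that has a bounded linear right inverse, there is a morphism of left Banach $\mathcal A$-modules $\psi:\mathcal A\to Y$ with $\varphi\circ\psi=\mathrm{id}_{\mathcal A}$; (ii) $\widehat{\mathcal A}$ is paracompact; (iii) $\mathcal A$ contains a strictly positive element, i.e. an element $a\ge 0$ with $f(a)>0$ for every non-zero positive linear functional $f$ on $\mathcal A$; (iv) $\widehat{\mathcal A}$ is $\sigma$-compact; (v) $\widehat{\mathcal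 A}$ is a Lindelöf space; (vi) $\mathcal A$ has a sequential approximate identity bounded by one, i.e. a sequence $(e_n)$ with $\|e_n\|\le 1$ for all $n$ and $\|e_na-a\|\to0$, $\|ae_n-a\|\to0$ for every $a\in\mathcal A$; (vii) $\mathcal H^2(\mathcal A,X)=\{0\}$ for every Banach $\mathcal A$-bimodule $X$ that is right annihilator, i.e. satisfies $x\cdot a=0$ for all $x\in X$, $a\in\mathcal A$. Here $\mathcal H^2(\mathcal A,X)=\ker\delta^2/\operatorname{im}\delta^1$ is the second continuous Hochschild cohomology group, where for bounded linear $g:\mathcal A\to X$ and bounded bilinear $f:\mathcal A\times\mathcal A\to X$ $$(\delta^1g)(a,b)=a\cdot g(b)-g(ab)+g(a)\cdot b,\qquad (\delta^2f)(a,b,c)=a\cdot f(b,c)-f(ab,c)+f(a,bc)-f(a,b)\cdot c.$$ A left Banach $\mathcal A$-module (Banach $\mathcal A$-bimodule) is a complex Banach space with a bounded bilinear associative left multiplication (commuting bounded bilinear associative left and right multiplications) by $\mathcal A$; morphisms are the bounded linear maps that commute with the multiplication. -/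

import Mathlib

open scoped ComplexOrder

universe u

set_option maxSynthPendingDepth 3

namespace BanachHomology

section Topology

/-- The Suslin number of a topological space: the smallest cardinal `m ≥ ℵ₀` such that every
family of non-empty, open, pairwise disjoint subsets has cardinality at most `m`. -/
noncomputable def suslinNumber (Ω : Type u) [TopologicalSpace Ω] : Cardinal.{u} :=
  sInf {m : Cardinal.{u} | Cardinal.aleph0 ≤ m ∧
    ∀ S : Set (Set Ω), (∀ U ∈ S, IsOpen U ∧ U.Nonempty) →
      S.PairwiseDisjoint id → Cardinal.mk S ≤ m}

/-- The Suslin condition: the Suslin number is `ℵ₀`. -/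
def SuslinCondition (Ω : Type u) [TopologicalSpace Ω] : Prop :=
  suslinNumber Ω = Cardinal.aleph0

end Topology

section Modules

variable (A : Type u) [NonUnitalNormedRing A] [NormedSpace ℂ A]

/-- The structure of a left Banach `A`-module on a normed space `X`: a bounded bilinear
associative multiplication `A × X → X`. (`A` need not be unital; completeness of `X` is required
separately, wherever modules are quantified over.) -/
structure LeftAction (X : Type u) [NormedAddCommGroup X] [NormedSpace ℂ X] where
  /-- The multiplication `(a, x) ↦ a · x`. -/
  act : A →L[ℂ] X →L[ℂ] X
  mul_act : ∀ (a b : A) (x : X), act (a * b) x = act a (act b x)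

/-- The structure of a Banach `A`-bimodule on a normed space `X`: `left a x = a · x` and
`right a x = x · a`. -/
structure BiAction (X : Type u) [NormedAddCommGroup X] [NormedSpace ℂ X] where
  /-- The left multiplication `(a, x) ↦ a · x`. -/
  left : A →L[ℂ] X →L[ℂ] X
  /-- The right multiplication `(a, x) ↦ x · a`. -/
  right : A →L[ℂ] X →L[ℂ] X
  mul_left : ∀ (a b : A) (x : X), left (a * b) x = left a (left b x)
  mul_right : ∀ (a b : A) (x : X), right (a * b) x = right b (right a x)
  left_right : ∀ (a b : A) (x : X), right b (left a x) = left a (right b x)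

variable {A}

/-- A bounded linear map between left Banach modules is a morphism of left modules. -/
def IsModuleHom {X Y : Type u} [NormedAddCommGroup X] [NormedSpace ℂ X]
    [NormedAddCommGroup Y] [NormedSpace ℂ Y]
    (αX : LeftAction A X) (αY : LeftAction A Y) (φ : X →L[ℂ] Y) : Prop :=
  ∀ (a : A) (x : X), φ (αX.act a x) = αY.act a (φ x)

/-- Projectivity of a left Banach module `P` in the category of left Banach `A`-modules: every
module morphism `φ : Y → P` that has a right inverse as a morphism of Banach spaces (so that `φ`
is in particular an epimorphism) has a right inverse that is a morphism of modules. -/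
def IsProjectiveModule {P : Type u} [NormedAddCommGroup P] [NormedSpace ℂ P]
    (αP : LeftAction A P) : Prop :=
  ∀ (Y : Type u) [NormedAddCommGroup Y] [NormedSpace ℂ Y] [CompleteSpace Y]
    (αY : LeftAction A Y) (φ : Y →L[ℂ] P), IsModuleHom αY αP φ →
    (∃ σ : P →L[ℂ] Y, φ.comp σ = ContinuousLinearMap.id ℂ P) →
    ∃ ψ : P →L[ℂ] Y, IsModuleHom αP αY ψ ∧ φ.comp ψ = ContinuousLinearMap.id ℂ P

/-- A bimodule is right annihilator if `x · a = 0` for all `x` and `a`. -/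
def BiAction.IsRightAnnihilator {X : Type u} [NormedAddCommGroup X] [NormedSpace ℂ X]
    (β : BiAction A X) : Prop :=
  ∀ (a : A) (x : X), β.right a x = 0

variable [IsScalarTower ℂ A A] [SMulCommClass ℂ A A]

variable (A) in
/-- `A` as a left module over itself. -/
noncomputable def LeftAction.regular : LeftAction A A where
  act := ContinuousLinearMap.mul ℂ A
  mul_act a b x := mul_assoc a b x

variable (A) in
/-- The algebra `A` is left projective: it is projective as a left Banach module over itself. -/
def IsLeftProjective : Prop :=
  IsProjectiveModule (LeftAction.regular A)

end Modules

section Cohomology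

/-- The cohomology `ker d' / im d` of `U → V → W` at `V` (used where `d' ∘ d = 0`). -/
abbrev CohomologyAt {U V W : Type u} [AddCommGroup U] [Module ℂ U] [AddCommGroup V] [Module ℂ V]
    [AddCommGroup W] [Module ℂ W] (d : U →ₗ[ℂ] V) (d' : V →ₗ[ℂ] W) : Type u :=
  LinearMap.ker d' ⧸ (LinearMap.range d).comap (LinearMap.ker d').subtype

variable {A : Type u} [NonUnitalNormedRing A] [NormedSpace ℂ A]
  [IsScalarTower ℂ A A] [SMulCommClass ℂ A A]
  {X : Type u} [NormedAddCommGroup X] [NormedSpace ℂ X]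

/-- The coboundary operator `δ¹ : C¹(A, X) → C²(A, X)` of the standard complex,
see `delta1_apply`. -/
noncomputable def BiAction.delta1 (β : BiAction A X) :
    (A →L[ℂ] X) →ₗ[ℂ] (A →L[ℂ] A →L[ℂ] X) where
  toFun g :=
    ((ContinuousLinearMap.compL ℂ A X X).flip g).comp β.left
      - (ContinuousLinearMap.compL ℂ A A X g).comp (ContinuousLinearMap.mul ℂ A)
      + β.right.flip.comp g
  map_add' g h := by
    ext a b
    simp
    abel
  map_smul' c g := by
    ext a b
    simp [smul_sub]

theorem BiAction.delta1_apply (β : BiAction A X) (g : A →L[ℂ] X) (a b : A) :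
    β.delta1 g a b = β.left a (g b) - g (a * b) + β.right b (g a) := rfl

/-- The coboundary operator `δ² : C²(A, X) → C³(A, X)` of the standard complex,
see `delta2_apply`. -/
noncomputable def BiAction.delta2 (β : BiAction A X) :
    (A →L[ℂ] A →L[ℂ] X) →ₗ[ℂ] (A →L[ℂ] A →L[ℂ] A →L[ℂ] X) where
  toFun f :=
    ((ContinuousLinearMap.compL ℂ A (A →L[ℂ] X) (A →L[ℂ] X)).flip f).comp
        ((ContinuousLinearMap.compL ℂ A X X).comp β.left)
      - (ContinuousLinearMap.compL ℂ A A (A →L[ℂ] X) f).comp (ContinuousLinearMap.mul ℂ A)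
      + ((ContinuousLinearMap.compL ℂ A (A →L[ℂ] A) (A →L[ℂ] X)).flip
          (ContinuousLinearMap.mul ℂ A)).comp ((ContinuousLinearMap.compL ℂ A A X).comp f)
      - (ContinuousLinearMap.compL ℂ A X (A →L[ℂ] X) β.right.flip).comp f
  map_add' f h := by
    ext a b c
    simp
    abel
  map_smul' r f := by
    ext a b c
    simp [smul_sub]

theorem BiAction.delta2_apply (β : BiAction A X) (f : A →L[ℂ] A →L[ℂ] X) (a b c : A) :
    β.delta2 f a b c =
      β.left a (f b c) - f (a * b) c + f a (b * c) - β.right c (f a b) := rfl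

theorem BiAction.delta2_delta1 (β : BiAction A X) (g : A →L[ℂ] X) :
    β.delta2 (β.delta1 g) = 0 := by
  ext a b c
  simp only [BiAction.delta2_apply, BiAction.delta1_apply, map_add, map_sub, β.mul_left,
    β.mul_right, β.left_right, mul_assoc, zero_apply]
  abel

/-- The second continuous Hochschild cohomology group `H²(A, X) = ker δ² / im δ¹`. -/
abbrev BiAction.H2 (β : BiAction A X) : Type u :=
  CohomologyAt β.delta1 β.delta2

end Cohomology

section CStar

variable {A : Type u} [NonUnitalCStarAlgebra A] [PartialOrder A] [StarOrderedRing A]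

/-- An element of a (not necessarily unital) C*-algebra is strictly positive if it is positive and
every non-zero positive linear functional takes a value `> 0` on it. (Mathlib's
`IsStrictlyPositive` is a different notion: it asks for invertibility.) -/
def StrictlyPositiveElement (a : A) : Prop :=
  0 ≤ a ∧ ∀ f : A →ₚ[ℂ] ℂ, f ≠ 0 → 0 < f a

end CStar

/-- A sequence `e` is an approximate identity bounded by one. -/
def IsSeqApproxIdentityBoundedByOne {A : Type u} [NonUnitalNormedRing A] (e : ℕ → A) : Prop :=
  (∀ n, ‖e n‖ ≤ 1) ∧ (Filter.map e Filter.atTop).IsApproximateUnit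

end BanachHomology

/-! Every condition is compared with σ-compactness of the spectrum, except that the cohomological
condition is tied to left projectivity: second cohomology with right annihilator coefficients
classifies the extensions of the left module `A` that split as Banach spaces.

The Suslin condition enters only on the way to σ-compactness from paracompactness and from
projectivity. In the first case it makes locally finite families of non-empty open sets countable.
In the second, projectivity gives a continuous `G : Â → A` with `s (G s) = 1`
(`exists_continuous_eval_eq_one`). The points `t` with `G t` within `1/2` of `G s` lie in the
compact set where the transform of `G s` is at least `1/2` in modulus, and by the Suslin condition
countably many such sets cover.

Conversely, σ-compactness gives an `a` with strictly positive Gelfand transform. Functional calculus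
turns `a` into an approximate identity and, once `‖a‖ ≤ 1`, into elements `w n` whose squares sum to
one pointwise and of which at most two are non-zero at each character. If `σ` is a bounded linear
right inverse, then `b ↦ ∑ (b * w n) · σ (w n)` is one that is a module morphism; the series
converges by averaging over signs (`norm_add_sum_bilinear_le`). -/

namespace BanachHomology

open WeakDual Filter Topology

/-! ### Gelfand theory without a unit. -/

section Gelfand

variable {A : Type u} [NonUnitalCommCStarAlgebra A]

theorem character_map_star (χ : characterSpace ℂ A) (a : A) : χ (star a) = star (χ a) := by
  let ψ : Unitization ℂ A →ₐ[ℂ] ℂ := Unitization.lift (CharacterSpace.toNonUnitalAlgHom χ)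
  have h : ∀ b : A, ψ (b : Unitization ℂ A) = χ b := fun b => by simp [ψ]
  have := AlgHomClass.instStarHomClass (F := Unitization ℂ A →ₐ[ℂ] ℂ) (A := Unitization ℂ A)
  rw [← h, ← h, Unitization.inr_star, map_star]

/-- A character of a commutative C⋆-algebra as a non-unital star homomorphism. -/
noncomputable def characterStarHom (χ : characterSpace ℂ A) : A →⋆ₙₐ[ℂ] ℂ :=
  { CharacterSpace.toNonUnitalAlgHom χ with map_star' := character_map_star χ }

theorem characterStarHom_apply (χ : characterSpace ℂ A) (a : A) :
    characterStarHom χ a = χ a := rfl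

theorem norm_character_le (χ : characterSpace ℂ A) (a : A) : ‖χ a‖ ≤ ‖a‖ :=
  NonUnitalStarAlgHom.norm_apply_le (characterStarHom χ) a

theorem continuous_eval_character (a : A) : Continuous fun χ : characterSpace ℂ A => χ a :=
  (eval_continuous a).comp continuous_subtype_val

theorem exists_character_ne_zero (χ : characterSpace ℂ A) : ∃ a, χ a ≠ 0 := by
  by_contra! h
  exact χ.2.1 (ContinuousLinearMap.ext h)

/-- The Gelfand transform of the unitization is isometric, and a character of the unitization
restricts to `A` either as zero or as a character. -/
theorem norm_le_of_forall_character {a : A} {c : ℝ} (hc : 0 ≤ c)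
    (h : ∀ χ : characterSpace ℂ A, ‖χ a‖ ≤ c) : ‖a‖ ≤ c := by
  rw [← Unitization.norm_inr (𝕜 := ℂ) a,
    ← (gelfandTransform_isometry (Unitization ℂ A)).norm_map_of_map_zero (map_zero _),
    ContinuousMap.norm_le _ hc]
  intro ψ
  let ρ : WeakDual ℂ A := StrongDual.toWeakDual
    ((CharacterSpace.toCLM ψ).comp
      (LinearMap.mkContinuous (Unitization.inrHom ℂ ℂ A) 1 fun x => by
        simp [Unitization.norm_inr]))
  have hρ : ∀ x : A, ρ x = ψ (x : Unitization ℂ A) := fun x => rfl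
  by_cases h0 : ρ = 0
  · have : ψ (a : Unitization ℂ A) = 0 := by rw [← hρ, h0]; rfl
    simpa [this] using hc
  · exact h ⟨ρ, h0, fun x y => by simp [hρ, Unitization.inr_mul]⟩

theorem eq_of_forall_character {a b : A} (h : ∀ χ : characterSpace ℂ A, χ a = χ b) : a = b := by
  rw [← sub_eq_zero, ← norm_le_zero_iff]
  exact norm_le_of_forall_character le_rfl fun χ => by simp [h]

/-- Characters together with zero form a weak-* closed set, and the lower bound at `a` excludes
zero; Banach–Alaoglu then applies. -/
theorem isCompact_character_ge (a : A) {ε : ℝ} (hε : 0 < ε) :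
    IsCompact {χ : characterSpace ℂ A | ε ≤ ‖χ a‖} := by
  rw [Subtype.isCompact_iff]
  have hset : ((↑) '' {χ : characterSpace ℂ A | ε ≤ ‖χ a‖} : Set (WeakDual ℂ A)) =
      {φ : WeakDual ℂ A | ∀ x y : A, φ (x * y) = φ x * φ y} ∩ {φ | ε ≤ ‖φ a‖} := by
    ext φ
    constructor
    · rintro ⟨χ, hχ, rfl⟩
      exact ⟨χ.2.2, hχ⟩
    · rintro ⟨h1, h2⟩
      refine ⟨⟨φ, ?_, h1⟩, h2, rfl⟩
      rintro rfl
      have h3 : ε ≤ ‖(0 : ℂ)‖ := h2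
      rw [norm_zero] at h3
      exact absurd h3 hε.not_ge
  have hcl : IsClosed ((↑) '' {χ : characterSpace ℂ A | ε ≤ ‖χ a‖} : Set (WeakDual ℂ A)) := by
    rw [hset]
    refine IsClosed.inter ?_ (isClosed_le continuous_const (eval_continuous a).norm)
    rw [← CharacterSpace.union_zero]
    exact CharacterSpace.union_zero_isClosed ℂ A
  refine (WeakDual.isCompact_closedBall (𝕜 := ℂ) (0 : StrongDual ℂ A) 1).of_isClosed_subset hcl ?_
  rintro _ ⟨χ, -, rfl⟩
  rw [Set.mem_preimage, mem_closedBall_zero_iff]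
  refine ContinuousLinearMap.opNorm_le_bound _ zero_le_one fun x => ?_
  rw [one_mul]
  exact norm_character_le χ x

theorem exists_isCompact_mem_nhds_character (χ : characterSpace ℂ A) :
    ∃ K : Set (characterSpace ℂ A), IsCompact K ∧ K ∈ 𝓝 χ := by
  obtain ⟨a, ha⟩ := exists_character_ne_zero χ
  have hpos : 0 < ‖χ a‖ := norm_pos_iff.2 ha
  refine ⟨_, isCompact_character_ge a (half_pos hpos), ?_⟩
  have := ((continuous_eval_character a).norm.tendsto χ).eventually (lt_mem_nhds (half_lt_self hpos))
  exact this.mono fun _ h => h.le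

instance instWeaklyLocallyCompactSpaceCharacterSpace :
    WeaklyLocallyCompactSpace (characterSpace ℂ A) :=
  ⟨exists_isCompact_mem_nhds_character⟩

theorem character_cfcₙ (χ : characterSpace ℂ A) {f : ℝ → ℝ} (hf : Continuous f) (hf0 : f 0 = 0)
    {a : A} (ha : IsSelfAdjoint a) : χ (cfcₙ f a) = f (χ a).re := by
  have hχa : IsSelfAdjoint (χ a) := by
    rw [isSelfAdjoint_iff, ← character_map_star, ha.star_eq]
  have hre : χ a = algebraMap ℝ ℂ (χ a).re := (Complex.conj_eq_iff_re.1 hχa).symm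
  have h := NonUnitalStarAlgHom.map_cfcₙ (characterStarHom χ) f a hf.continuousOn hf0
    (map_continuous χ) ha hχa
  rw [characterStarHom_apply, characterStarHom_apply] at h
  rw [h, cfcₙ_eq_cfc (hf := hf.continuousOn) (hf0 := hf0), hre, cfc_algebraMap]
  simp

variable [PartialOrder A] [StarOrderedRing A]

theorem character_nonneg (χ : characterSpace ℂ A) {a : A} (ha : 0 ≤ a) : 0 ≤ χ a := by
  obtain ⟨b, rfl⟩ := CStarAlgebra.nonneg_iff_eq_star_mul_self.1 ha
  rw [map_mul, character_map_star]
  exact star_mul_self_nonneg _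

theorem nonneg_of_forall_character {a : A} (h : ∀ χ : characterSpace ℂ A, 0 ≤ χ a) : 0 ≤ a := by
  have ha : IsSelfAdjoint a := eq_of_forall_character fun χ => by
    rw [character_map_star]
    exact (IsSelfAdjoint.of_nonneg (h χ)).star_eq
  have : a = cfcₙ (fun t : ℝ => |t|) a := eq_of_forall_character fun χ => by
    rw [character_cfcₙ χ continuous_abs abs_zero ha, abs_of_nonneg (Complex.nonneg_iff.1 (h χ)).1]
    exact Complex.ext rfl (by simpa using! (Complex.nonneg_iff.1 (h χ)).2.symm)
  rw [this]
  exact cfcₙ_nonneg fun x _ => abs_nonneg x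

/-- A character of a commutative C⋆-algebra as a positive linear functional. -/
noncomputable def characterPositive (χ : characterSpace ℂ A) : A →ₚ[ℂ] ℂ :=
  PositiveLinearMap.mk₀ (CharacterSpace.toCLM χ : A →ₗ[ℂ] ℂ) fun _ ha => character_nonneg χ ha

end Gelfand

/-! ### The Suslin condition and σ-compactness. -/

section SuslinTopology

variable {Ω : Type u} [TopologicalSpace Ω]

theorem SuslinCondition.countable (h : SuslinCondition Ω) {S : Set (Set Ω)}
    (hS : ∀ U ∈ S, IsOpen U ∧ U.Nonempty) (hd : S.PairwiseDisjoint id) : S.Countable := by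
  -- The infimum of the empty set is `0`, not `ℵ₀`; so the set is non-empty and the infimum is
  -- attained.
  have hne : {m : Cardinal.{u} | Cardinal.aleph0 ≤ m ∧
      ∀ S : Set (Set Ω), (∀ U ∈ S, IsOpen U ∧ U.Nonempty) →
        S.PairwiseDisjoint id → Cardinal.mk S ≤ m}.Nonempty := by
    rw [Set.nonempty_iff_ne_empty]
    intro he
    unfold SuslinCondition suslinNumber at h
    rw [he, Cardinal.sInf_empty] at h
    exact Cardinal.aleph0_ne_zero h.symm
  have := (csInf_mem hne).2 S hS hd
  rw [← Cardinal.le_aleph0_iff_set_countable]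
  exact this.trans_eq h

theorem SuslinCondition.countable_index (h : SuslinCondition Ω) {ι : Type*} {s : Set ι}
    {U : ι → Set Ω} (hU : ∀ i ∈ s, IsOpen (U i) ∧ (U i).Nonempty)
    (hd : s.PairwiseDisjoint U) : s.Countable := by
  have hinj : s.InjOn U := fun i hi j hj hij => by
    by_contra hne
    have := hd hi hj hne
    rw [Function.onFun, hij, disjoint_self] at this
    exact (hU j hj).2.ne_empty this
  refine Set.countable_of_injective_of_countable_image hinj (h.countable ?_ ?_)
  · rintro _ ⟨i, hi, rfl⟩
    exact hU i hi
  · rintro _ ⟨i, hi, rfl⟩ _ ⟨j, hj, rfl⟩ hne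
    exact hd hi hj fun hij => hne (by rw [hij])

/-- In a space that satisfies the Suslin condition, a locally finite family of non-empty open sets
is countable. -/
theorem SuslinCondition.countable_of_locallyFinite (h : SuslinCondition Ω) {ι : Type*}
    {U : ι → Set Ω} (hU : ∀ i, IsOpen (U i)) (hf : LocallyFinite U) :
    {i | (U i).Nonempty}.Countable := by
  -- A maximal disjoint family of open sets, each meeting only finitely many `U i`, is countable.
  -- Every non-empty `U i` meets one of its members: otherwise a small open piece of `U i` could be
  -- added.
  let P : Set (Set (Set Ω)) := {S | (∀ V ∈ S, (IsOpen V ∧ V.Nonempty) ∧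
    {i | (U i ∩ V).Nonempty}.Finite) ∧ S.PairwiseDisjoint id}
  obtain ⟨S, hS⟩ : ∃ S, Maximal (· ∈ P) S := by
    refine zorn_subset P fun c hc hchain => ⟨⋃₀ c, ⟨?_, ?_⟩, fun s hs => Set.subset_sUnion_of_mem hs⟩
    · rintro V ⟨S, hS, hV⟩
      exact (hc hS).1 V hV
    · exact (Set.pairwiseDisjoint_sUnion hchain.directedOn).2 fun S hS => (hc hS).2
  have hcount : S.Countable := h.countable (fun V hV => (hS.prop.1 V hV).1) hS.prop.2
  refine (hcount.biUnion fun V hV => (hS.prop.1 V hV).2.countable).mono ?_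
  rintro i ⟨x, hx⟩
  by_contra hcon
  simp only [Set.mem_iUnion, Set.mem_ofPred_eq, not_exists, Set.not_nonempty_iff_eq_empty] at hcon
  obtain ⟨t, ht, htf⟩ := hf x
  obtain ⟨W, hWt, hW, hxW⟩ := mem_nhds_iff.1 ht
  have hdisj : ∀ V ∈ S, Disjoint (U i ∩ W) V := fun V hV => by
    rw [Set.disjoint_iff_inter_eq_empty, ← Set.subset_empty_iff, ← hcon V hV]
    exact fun y hy => ⟨hy.1.1, hy.2⟩
  have hmem : insert (U i ∩ W) S ∈ P := by
    refine ⟨?_, ?_⟩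
    · rintro V (rfl | hV)
      · exact ⟨⟨(hU i).inter hW, x, hx, hxW⟩, htf.subset fun j ⟨y, hy⟩ => ⟨y, hy.1, hWt hy.2.2⟩⟩
      · exact hS.prop.1 V hV
    · exact hS.prop.2.insert fun V hV _ => hdisj V hV
  have hin : U i ∩ W ∈ S := hS.le_of_ge hmem (Set.subset_insert _ _) (Set.mem_insert _ _)
  have := hdisj _ hin
  rw [disjoint_self] at this
  exact Set.notMem_empty x (this.subset ⟨hx, hxW⟩)

theorem SuslinCondition.sigmaCompactSpace_of_paracompactSpace [T2Space Ω]
    [WeaklyLocallyCompactSpace Ω] [ParacompactSpace Ω] (h : SuslinCondition Ω) :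
    SigmaCompactSpace Ω := by
  choose K hK hKn using fun x : Ω => exists_compact_mem_nhds x
  obtain ⟨v, hv, hcov, hlf, hsub⟩ := precise_refinement (fun x => interior (K x))
    (fun x => isOpen_interior)
    (Set.eq_univ_of_forall fun x => Set.mem_iUnion.2 ⟨x, mem_interior_iff_mem_nhds.2 (hKn x)⟩)
  refine SigmaCompactSpace.of_countable (K '' {i | (v i).Nonempty})
    ((h.countable_of_locallyFinite hv hlf).image K) ?_ ?_
  · rintro _ ⟨i, -, rfl⟩
    exact hK i
  · refine Set.eq_univ_of_forall fun x => ?_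
    obtain ⟨i, hi⟩ := Set.mem_iUnion.1 (hcov.symm ▸ Set.mem_univ x : x ∈ ⋃ i, v i)
    exact ⟨K i, ⟨i, ⟨x, hi⟩, rfl⟩, interior_subset (hsub i hi)⟩

theorem sigmaCompactSpace_of_lindelofSpace [WeaklyLocallyCompactSpace Ω] [LindelofSpace Ω] :
    SigmaCompactSpace Ω := by
  choose K hK hKn using fun x : Ω => exists_compact_mem_nhds x
  obtain ⟨t, ht, hcov⟩ := LindelofSpace.elim_nhds_subcover K hKn
  refine SigmaCompactSpace.of_countable (K '' t) (ht.image K) ?_ ?_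
  · rintro _ ⟨i, -, rfl⟩
    exact hK i
  · rw [Set.sUnion_image, hcov]

/-- A space that satisfies the Suslin condition is σ-compact if it has a continuous map into a
metric space under which preimages of balls of some fixed radius lie in compact sets. -/
theorem SuslinCondition.sigmaCompactSpace_of_continuous {E : Type*} [PseudoMetricSpace E]
    (h : SuslinCondition Ω) {G : Ω → E} (hG : Continuous G) {r : ℝ} (hr : 0 < r)
    (hK : ∀ x, ∃ K : Set Ω, IsCompact K ∧ ∀ y, dist (G y) (G x) < r → y ∈ K) :
    SigmaCompactSpace Ω := by
  -- Take a maximal set with `r`-separated images. Balls of radius `r / 2` about these have disjoint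
  -- preimages, so the set is countable; by maximality the compact sets attached to its points
  -- cover.
  let P : Set (Set Ω) := {S | S.Pairwise fun x y => r ≤ dist (G x) (G y)}
  obtain ⟨S, hS⟩ : ∃ S, Maximal (· ∈ P) S := by
    refine zorn_subset P fun c hc hchain => ⟨⋃₀ c, ?_, fun s hs => Set.subset_sUnion_of_mem hs⟩
    exact (Set.pairwise_sUnion hchain.directedOn).2 fun S hS => hc hS
  have hcount : S.Countable := by
    refine h.countable_index (U := fun x => G ⁻¹' Metric.ball (G x) (r / 2))
      (fun x _ => ⟨Metric.isOpen_ball.preimage hG, x, Metric.mem_ball_self (half_pos hr)⟩) ?_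
    intro x hx y hy hxy
    refine Disjoint.preimage _ (Metric.ball_disjoint_ball ?_)
    linarith [hS.prop hx hy hxy]
  choose K hKc hKb using hK
  refine SigmaCompactSpace.of_countable (K '' S) (hcount.image K) ?_ ?_
  · rintro _ ⟨i, -, rfl⟩
    exact hKc i
  · refine Set.eq_univ_of_forall fun y => ?_
    by_contra hy
    have hfar : ∀ x ∈ S, r ≤ dist (G y) (G x) := fun x hx => by
      by_contra! hlt
      exact hy ⟨K x, ⟨x, hx, rfl⟩, hKb x y hlt⟩
    have hmem : insert y S ∈ P := hS.prop.insert fun x hx _ =>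
      ⟨hfar x hx, by rw [dist_comm]; exact hfar x hx⟩
    have hyS : y ∈ S := hS.le_of_ge hmem (Set.subset_insert _ _) (Set.mem_insert _ _)
    have := hfar y hyS
    rw [dist_self] at this
    exact this.not_gt hr

end SuslinTopology

/-! ### Second cohomology and extensions of the left module `A`. -/

section Extension

variable {A : Type u} [NonUnitalNormedRing A] [NormedSpace ℂ A]

/-- The bimodule with trivial right multiplication on the kernel of a morphism of left modules. -/
noncomputable def BiAction.ofKer {Y P : Type u} [NormedAddCommGroup Y] [NormedSpace ℂ Y]
    [NormedAddCommGroup P] [NormedSpace ℂ P]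
    {αY : LeftAction A Y} {αP : LeftAction A P} {φ : Y →L[ℂ] P} (hφ : IsModuleHom αY αP φ) :
    BiAction A φ.ker where
  left := LinearMap.mkContinuous₂
    (LinearMap.mk₂ ℂ (fun (a : A) (y : φ.ker) => (⟨αY.act a y, by
        have : φ y = 0 := y.2
        rw [LinearMap.mem_ker, ContinuousLinearMap.coe_coe, hφ, this, map_zero]⟩ : φ.ker))
      (fun a b y => by ext; simp) (fun c a y => by ext; simp)
      (fun a y z => by ext; simp) (fun c a y => by ext; simp)) ‖αY.act‖
    (fun a y => αY.act.le_opNorm₂ a y)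
  right := 0
  mul_left a b x := by ext; exact αY.mul_act a b x
  mul_right a b x := rfl
  left_right a b x := by simp

theorem BiAction.coe_ofKer_left {Y P : Type u} [NormedAddCommGroup Y] [NormedSpace ℂ Y]
    [NormedAddCommGroup P] [NormedSpace ℂ P]
    {αY : LeftAction A Y} {αP : LeftAction A P} {φ : Y →L[ℂ] P} (hφ : IsModuleHom αY αP φ)
    (a : A) (y : φ.ker) : ((BiAction.ofKer hφ).left a y : Y) = αY.act a y := rfl

variable [IsScalarTower ℂ A A] [SMulCommClass ℂ A A]

theorem subsingleton_H2_iff {X : Type u} [NormedAddCommGroup X] [NormedSpace ℂ X]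
    (β : BiAction A X) :
    Subsingleton β.H2 ↔ ∀ f, β.delta2 f = 0 → ∃ g, β.delta1 g = f := by
  rw [Submodule.Quotient.subsingleton_iff, eq_top_iff]
  exact ⟨fun h f hf => h (x := ⟨f, hf⟩) trivial, fun h f _ => h f.1 f.2⟩

/-- The extension of the left module `A` by `X` that a cocycle `f` defines. -/
noncomputable def LeftAction.ofCocycle {X : Type u} [NormedAddCommGroup X] [NormedSpace ℂ X]
    (β : BiAction A X) (f : A →L[ℂ] A →L[ℂ] X)
    (hf : ∀ a b c, f (a * b) c = β.left a (f b c) + f a (b * c)) : LeftAction A (X × A) where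
  act :=
    (ContinuousLinearMap.compL ℂ (X × A) X (X × A) (ContinuousLinearMap.inl ℂ X A)).comp
        (((ContinuousLinearMap.compL ℂ (X × A) X X).flip (ContinuousLinearMap.fst ℂ X A)).comp
          β.left +
        ((ContinuousLinearMap.compL ℂ (X × A) A X).flip (ContinuousLinearMap.snd ℂ X A)).comp f) +
      (ContinuousLinearMap.compL ℂ (X × A) A (X × A) (ContinuousLinearMap.inr ℂ X A)).comp
        (((ContinuousLinearMap.compL ℂ (X × A) A A).flip (ContinuousLinearMap.snd ℂ X A)).comp
          (ContinuousLinearMap.mul ℂ A))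
  mul_act a b x := by
    ext
    · simp [β.mul_left, hf, add_assoc]
    · simp [mul_assoc]

theorem LeftAction.ofCocycle_apply {X : Type u} [NormedAddCommGroup X] [NormedSpace ℂ X]
    (β : BiAction A X) (f : A →L[ℂ] A →L[ℂ] X)
    (hf : ∀ a b c, f (a * b) c = β.left a (f b c) + f a (b * c)) (a : A) (x : X × A) :
    (LeftAction.ofCocycle β f hf).act a x = (β.left a x.1 + f a x.2, a * x.2) := by
  ext <;> simp [LeftAction.ofCocycle]

/-- A module splitting of the extension defined by `f` has the form `a ↦ (g a, a)` with `g (a * b) =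
a · g b + f a b`, so `f` is the coboundary of `-g`. -/
theorem subsingleton_H2_of_isLeftProjective [CompleteSpace A] (h : IsLeftProjective A) (X : Type u)
    [NormedAddCommGroup X] [NormedSpace ℂ X] [CompleteSpace X] (β : BiAction A X)
    (hβ : β.IsRightAnnihilator) : Subsingleton β.H2 := by
  rw [subsingleton_H2_iff]
  intro f hf
  have hf' : ∀ a b c, f (a * b) c = β.left a (f b c) + f a (b * c) := fun a b c => by
    have h0 : β.delta2 f a b c = 0 := by rw [hf]; rfl
    rw [BiAction.delta2_apply, hβ, sub_zero] at h0
    rw [eq_comm, ← sub_eq_zero, ← h0]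
    abel
  obtain ⟨ψ, hψ, hφψ⟩ := h (X × A) (LeftAction.ofCocycle β f hf') (ContinuousLinearMap.snd ℂ X A)
    (fun a x => by rw [LeftAction.ofCocycle_apply]; rfl) ⟨ContinuousLinearMap.inr ℂ X A, rfl⟩
  have h2 : ∀ a, (ψ a).2 = a := fun a => DFunLike.congr_fun hφψ a
  refine ⟨-((ContinuousLinearMap.fst ℂ X A).comp ψ), ?_⟩
  ext a b
  have h1 : (ψ (a * b)).1 = β.left a (ψ b).1 + f a b := by
    have := hψ a b
    rw [LeftAction.ofCocycle_apply, h2] at this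
    exact congrArg Prod.fst this
  rw [BiAction.delta1_apply, hβ]
  simp [h1]

/-- The defect `a · σ b - σ (a * b)` of a linear right inverse `σ` is a cocycle with values in the
kernel. If it is the coboundary of `g`, then `σ - g` is a morphism. -/
theorem isLeftProjective_of_subsingleton_H2
    (h : ∀ (X : Type u) [NormedAddCommGroup X] [NormedSpace ℂ X] [CompleteSpace X]
      (β : BiAction A X), β.IsRightAnnihilator → Subsingleton β.H2) : IsLeftProjective A := by
  intro Y _ _ _ αY φ hφ ⟨σ, hσ⟩
  have hφσ : ∀ a, φ (σ a) = a := fun a => DFunLike.congr_fun hσ a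
  have : CompleteSpace φ.ker := φ.isClosed_ker.completeSpace_coe
  let β := BiAction.ofKer hφ
  let F : A →L[ℂ] A →L[ℂ] Y :=
    ((ContinuousLinearMap.compL ℂ A Y Y).flip σ).comp αY.act
      - (ContinuousLinearMap.compL ℂ A A Y σ).comp (ContinuousLinearMap.mul ℂ A)
  have hF : ∀ a b, F a b = αY.act a (σ b) - σ (a * b) := fun a b => rfl
  have hFk : ∀ a b, F a b ∈ φ.ker := fun a b => by
    rw [LinearMap.mem_ker, ContinuousLinearMap.coe_coe, hF, map_sub, hφ, hφσ, hφσ]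
    exact sub_self _
  let f : A →L[ℂ] A →L[ℂ] φ.ker := LinearMap.mkContinuous₂
    (LinearMap.mk₂ ℂ (fun a b => (⟨F a b, hFk a b⟩ : φ.ker))
      (fun a b y => by ext; simp) (fun c a y => by ext; simp)
      (fun a y z => by ext; simp) (fun c a y => by ext; simp)) ‖F‖
    (fun a b => F.le_opNorm₂ a b)
  have hf : ∀ a b, (f a b : Y) = αY.act a (σ b) - σ (a * b) := fun a b => rfl
  obtain ⟨g, hg⟩ := (subsingleton_H2_iff β).1 (h φ.ker β fun _ _ => rfl) f (by
    ext a b c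
    rw [BiAction.delta2_apply]
    have h0 : β.right c (f a b) = 0 := rfl
    rw [h0]
    simp only [Submodule.coe_sub, Submodule.coe_add, hf, β, BiAction.coe_ofKer_left, map_sub,
      αY.mul_act, mul_assoc]
    simp)
  refine ⟨σ - φ.ker.subtypeL.comp g, fun a b => ?_, ?_⟩
  · have h1 : β.delta1 g a b = f a b := by rw [hg]
    have h2 : αY.act a (g b) - g (a * b) = αY.act a (σ b) - σ (a * b) := by
      rw [← hf, ← h1, BiAction.delta1_apply]
      have h0 : β.right b (g a) = 0 := rfl
      rw [h0, add_zero]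
      rfl
    change σ (a * b) - g (a * b) = αY.act a (σ b - g b)
    rw [map_sub]
    rw [sub_eq_sub_iff_add_eq_add] at h2 ⊢
    rw [add_comm (σ _), h2]
  · ext b
    have : φ (g b) = 0 := (g b).2
    change φ (σ b - g b) = b
    rw [map_sub, this, sub_zero, hφσ]

end Extension

/-! ### From projectivity to σ-compactness. -/

section Necessity

open scoped BoundedContinuousFunction

variable (A : Type u) [NonUnitalCommCStarAlgebra A]

/-- The pairs of a bounded continuous function `F : Â → A` and an element `a` of `A` that is the
restriction of `F`, read as a function of two variables, to the diagonal. -/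
def diagonalSubmodule : Submodule ℂ ((characterSpace ℂ A →ᵇ A) × A) where
  carrier := {p | ∀ s : characterSpace ℂ A, s (p.1 s) = s p.2}
  add_mem' hp hq s := by simp [hp s, hq s]
  zero_mem' s := by simp
  smul_mem' c p hp s := by simp [hp s]

theorem isClosed_diagonalSubmodule :
    IsClosed (diagonalSubmodule A : Set ((characterSpace ℂ A →ᵇ A) × A)) := by
  have : (diagonalSubmodule A : Set ((characterSpace ℂ A →ᵇ A) × A)) =
      ⋂ s : characterSpace ℂ A, {p | s (p.1 s) = s p.2} := by
    ext p
    simp only [Set.mem_iInter]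
    rfl
  rw [this]
  refine isClosed_iInter fun s => isClosed_eq ?_ ?_
  · exact (map_continuous s).comp
      ((BoundedContinuousFunction.lipschitz_eval_const s).continuous.comp continuous_fst)
  · exact (map_continuous s).comp continuous_snd

variable {A}

/-- The product of the Gelfand transform of `b` and `F`. -/
noncomputable def gelfandSMul (b : A) (F : characterSpace ℂ A →ᵇ A) : characterSpace ℂ A →ᵇ A :=
  BoundedContinuousFunction.ofNormedAddCommGroup (fun s => s b • F s)
    ((continuous_eval_character b).smul F.continuous) (‖b‖ * ‖F‖) fun s => by
      rw [norm_smul]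
      exact mul_le_mul (norm_character_le s b) (F.norm_coe_le_norm s) (norm_nonneg _) (norm_nonneg _)

theorem gelfandSMul_apply (b : A) (F : characterSpace ℂ A →ᵇ A) (s : characterSpace ℂ A) :
    gelfandSMul b F s = s b • F s := rfl

theorem norm_gelfandSMul_le (b : A) (F : characterSpace ℂ A →ᵇ A) :
    ‖gelfandSMul b F‖ ≤ ‖b‖ * ‖F‖ :=
  BoundedContinuousFunction.norm_ofNormedAddCommGroup_le _ (by positivity) _

variable (A) in
/-- `A` acts on the first variable of the functions in `diagonalSubmodule A`. -/
noncomputable def diagonalBilinear :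
    A →ₗ[ℂ] diagonalSubmodule A →ₗ[ℂ] diagonalSubmodule A :=
  LinearMap.mk₂ ℂ (fun (b : A) (p : diagonalSubmodule A) =>
      (⟨(gelfandSMul b p.1.1, b * p.1.2), fun s => by
        simp [gelfandSMul_apply, p.2 s]⟩ : diagonalSubmodule A))
    (fun a b y => Subtype.ext <| Prod.ext
      (by ext s; simp [gelfandSMul_apply, add_smul]) (add_mul a b y.1.2))
    (fun c a y => Subtype.ext <| Prod.ext
      (by ext s; simp [gelfandSMul_apply, mul_smul]) (smul_mul_assoc c a y.1.2))
    (fun a y z => Subtype.ext <| Prod.ext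
      (by ext s; simp [gelfandSMul_apply]) (mul_add a y.1.2 z.1.2))
    (fun c a y => Subtype.ext <| Prod.ext
      (BoundedContinuousFunction.ext fun s => smul_comm (s a) c (y.1.1 s))
      (mul_smul_comm c a y.1.2))

theorem norm_diagonalBilinear_le (b : A) (p : diagonalSubmodule A) :
    ‖diagonalBilinear A b p‖ ≤ 1 * ‖b‖ * ‖p‖ := by
  have h1 : ‖p.1.1‖ ≤ ‖p‖ := norm_fst_le p.1
  have h2 : ‖p.1.2‖ ≤ ‖p‖ := norm_snd_le p.1
  rw [one_mul]
  change max ‖gelfandSMul b p.1.1‖ ‖b * p.1.2‖ ≤ _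
  refine max_le ((norm_gelfandSMul_le _ _).trans ?_) ((norm_mul_le _ _).trans ?_)
  · exact mul_le_mul_of_nonneg_left h1 (norm_nonneg _)
  · exact mul_le_mul_of_nonneg_left h2 (norm_nonneg _)

variable (A) in
/-- The Banach module structure on `diagonalSubmodule A`. -/
noncomputable def diagonalAction : LeftAction A (diagonalSubmodule A) where
  act := (diagonalBilinear A).mkContinuous₂ 1 norm_diagonalBilinear_le
  mul_act a b p := Subtype.ext <| Prod.ext
    (BoundedContinuousFunction.ext fun s =>
      (congrArg (· • p.1.1 s) (map_mul s a b)).trans (mul_smul (s a) (s b) (p.1.1 s)))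
    (mul_assoc a b p.1.2)

theorem diagonalAction_fst (b : A) (p : diagonalSubmodule A) (s : characterSpace ℂ A) :
    ((diagonalAction A).act b p).1.1 s = s b • p.1.1 s := rfl

/-- Constant functions split the projection of `diagonalSubmodule A` to `A` linearly. For a module
splitting `ψ`, commutativity makes `ψ b` at `s`, divided by `s b`, independent of `b` with `s b ≠
0`. This quotient is `G s`, and the diagonal condition normalizes it. -/
theorem exists_continuous_eval_eq_one (h : IsLeftProjective A) :
    ∃ G : characterSpace ℂ A → A, Continuous G ∧ ∀ s : characterSpace ℂ A, s (G s) = 1 := by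
  have : CompleteSpace (diagonalSubmodule A) := (isClosed_diagonalSubmodule A).completeSpace_coe
  let φ : diagonalSubmodule A →L[ℂ] A :=
    (ContinuousLinearMap.snd ℂ _ _).comp (diagonalSubmodule A).subtypeL
  let σ : A →L[ℂ] diagonalSubmodule A := LinearMap.mkContinuous
    { toFun := fun a => ⟨(BoundedContinuousFunction.const _ a, a), fun s => rfl⟩
      map_add' := fun a b => rfl
      map_smul' := fun c a => rfl } 1 fun a => by
        rw [one_mul]
        exact max_le (BoundedContinuousFunction.norm_const_le a) le_rfl
  obtain ⟨ψ, hψ, hφψ⟩ := h (diagonalSubmodule A) (diagonalAction A) φ (fun a p => rfl) ⟨σ, rfl⟩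
  have h2 : ∀ a, (ψ a).1.2 = a := fun a => DFunLike.congr_fun hφψ a
  have hmul : ∀ (a b : A) (s : characterSpace ℂ A),
      (ψ (a * b)).1.1 s = s a • (ψ b).1.1 s := fun a b s => by
    have := hψ a b
    rw [← diagonalAction_fst, ← this]
    rfl
  choose b hb using fun s : characterSpace ℂ A => exists_character_ne_zero s
  refine ⟨fun s => (s (b s))⁻¹ • (ψ (b s)).1.1 s, ?_, fun s => ?_⟩
  · rw [continuous_iff_continuousAt]
    intro s
    have hev : ∀ᶠ t : characterSpace ℂ A in 𝓝 s, t (b s) ≠ 0 :=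
      (continuous_eval_character (b s)).continuousAt.eventually_ne (hb s)
    -- Near `s` the fixed element `b s` gives the same quotient as the element `b t` chosen at `t`.
    have hc : ContinuousAt
        (fun t : characterSpace ℂ A => (t (b s))⁻¹ • (ψ (b s)).1.1 t) s :=
      ((continuous_eval_character (b s)).continuousAt.inv₀ (hb s)).smul
        (ψ (b s)).1.1.continuous.continuousAt
    refine hc.congr ?_
    filter_upwards [hev] with t ht
    rw [inv_smul_eq_iff₀ ht, smul_smul, mul_comm, ← smul_smul, eq_inv_smul_iff₀ (hb t), ← hmul,
      ← hmul, mul_comm]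
  · rw [map_smul, (ψ (b s)).2 s, h2, smul_eq_mul, inv_mul_cancel₀ (hb s)]

theorem SuslinCondition.sigmaCompactSpace_of_isLeftProjective
    (hA : SuslinCondition (characterSpace ℂ A)) (h : IsLeftProjective A) :
    SigmaCompactSpace (characterSpace ℂ A) := by
  obtain ⟨G, hG, hG1⟩ := exists_continuous_eval_eq_one h
  refine hA.sigmaCompactSpace_of_continuous hG one_half_pos fun s =>
    ⟨_, isCompact_character_ge (G s) one_half_pos, fun t ht => ?_⟩
  rw [dist_eq_norm] at ht
  have h1 := (norm_character_le t (G t - G s)).trans_lt ht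
  rw [map_sub, hG1] at h1
  have h2 := norm_sub_norm_le (1 : ℂ) (t (G s))
  rw [norm_one] at h2
  change 1 / 2 ≤ ‖t (G s)‖
  linarith

end Necessity

/-! ### A dyadic partition of unity on the positive reals. -/

section Cutoff

/-- The continuous function that vanishes for `2 ^ n * t ≤ 1`, is `1` for `2 ^ n * t ≥ 2` and is
affine in between. -/
noncomputable def cutoff (n : ℕ) (t : ℝ) : ℝ := max 0 (min 1 (2 ^ n * t - 1))

/-- The functions whose squares are the differences of consecutive cutoff functions. -/
noncomputable def bump (n : ℕ) (t : ℝ) : ℝ := √(cutoff (n + 1) t - cutoff n t)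

theorem continuous_cutoff (n : ℕ) : Continuous (cutoff n) := by
  unfold cutoff; fun_prop

theorem continuous_bump (n : ℕ) : Continuous (bump n) :=
  ((continuous_cutoff _).sub (continuous_cutoff _)).sqrt

theorem cutoff_nonneg (n : ℕ) (t : ℝ) : 0 ≤ cutoff n t := le_max_left _ _

theorem cutoff_le_one (n : ℕ) (t : ℝ) : cutoff n t ≤ 1 :=
  max_le zero_le_one (min_le_left _ _)

theorem cutoff_le_mul (n : ℕ) {t : ℝ} (ht : 0 ≤ t) : cutoff n t ≤ 2 ^ n * t :=
  max_le (by positivity) ((min_le_right _ _).trans (by linarith))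

theorem cutoff_of_le {n : ℕ} {t : ℝ} (h : 2 ^ n * t ≤ 1) : cutoff n t = 0 :=
  max_eq_left ((min_le_right _ _).trans (by linarith))

theorem cutoff_of_ge {n : ℕ} {t : ℝ} (h : 2 ≤ 2 ^ n * t) : cutoff n t = 1 := by
  rw [cutoff, min_eq_left (by linarith), max_eq_right zero_le_one]

theorem cutoff_apply_zero (n : ℕ) : cutoff n 0 = 0 := cutoff_of_le (by simp)

theorem bump_apply_zero (n : ℕ) : bump n 0 = 0 := by simp [bump, cutoff_apply_zero]

theorem cutoff_le_succ (n : ℕ) {t : ℝ} (ht : 0 ≤ t) : cutoff n t ≤ cutoff (n + 1) t := by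
  unfold cutoff
  have : (2 : ℝ) ^ n ≤ 2 ^ (n + 1) := pow_le_pow_right₀ one_le_two (Nat.le_succ n)
  gcongr

theorem bump_nonneg (n : ℕ) (t : ℝ) : 0 ≤ bump n t := Real.sqrt_nonneg _

theorem bump_le_one (n : ℕ) (t : ℝ) : bump n t ≤ 1 :=
  Real.sqrt_le_one.2 (by linarith [cutoff_le_one (n + 1) t, cutoff_nonneg n t])

theorem bump_mul_self (n : ℕ) {t : ℝ} (ht : 0 ≤ t) :
    bump n t * bump n t = cutoff (n + 1) t - cutoff n t :=
  Real.mul_self_sqrt (sub_nonneg.2 (cutoff_le_succ n ht))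

theorem bump_of_ge {n : ℕ} {t : ℝ} (h : 2 ≤ 2 ^ n * t) : bump n t = 0 := by
  have h' : 2 ≤ 2 ^ (n + 1) * t := by rw [pow_succ]; linarith
  rw [bump, cutoff_of_ge h, cutoff_of_ge h', sub_self, Real.sqrt_zero]

theorem bump_of_le {n : ℕ} {t : ℝ} (ht : 0 ≤ t) (h : 2 ^ (n + 1) * t ≤ 1) : bump n t = 0 := by
  have h' : 2 ^ n * t ≤ 1 := by
    have : 0 ≤ 2 ^ n * t := by positivity
    rw [pow_succ] at h
    linarith
  rw [bump, cutoff_of_le h, cutoff_of_le h', sub_self, Real.sqrt_zero]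

/-- A non-zero `bump n t` forces `1 < 2 ^ (n + 1) * t` and `2 ^ n * t < 2`, which leaves at most two
consecutive indices. -/
theorem sum_bump_le_two (s : Finset ℕ) {t : ℝ} (ht : 0 ≤ t) : ∑ n ∈ s, bump n t ≤ 2 := by
  classical
  rw [← Finset.sum_filter_ne_zero]
  rcases (s.filter fun n => bump n t ≠ 0).eq_empty_or_nonempty with he | hne
  · rw [he, Finset.sum_empty]; exact zero_le_two
  obtain ⟨m, hm, hmin⟩ := Finset.exists_min_image _ id hne
  have hm1 : 1 < 2 ^ (m + 1) * t := by
    by_contra! h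
    exact (Finset.mem_filter.1 hm).2 (bump_of_le ht h)
  have hsub : (s.filter fun n => bump n t ≠ 0) ⊆ {m, m + 1} := by
    intro n hn
    have h1 : m ≤ n := hmin n hn
    have h2 : n < m + 2 := by
      by_contra! h
      refine (Finset.mem_filter.1 hn).2 (bump_of_ge ?_)
      have h3 : (2 : ℝ) ^ (m + 2) * t ≤ 2 ^ n * t :=
        mul_le_mul_of_nonneg_right (pow_le_pow_right₀ one_le_two h) ht
      have h4 : (2 : ℝ) ^ (m + 2) * t = 2 * (2 ^ (m + 1) * t) := by ring
      linarith
    rw [Finset.mem_insert, Finset.mem_singleton]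
    lia
  calc ∑ n ∈ s.filter fun n => bump n t ≠ 0, bump n t
      ≤ ∑ n ∈ {m, m + 1}, bump n t :=
        Finset.sum_le_sum_of_subset_of_nonneg hsub fun i _ _ => bump_nonneg i t
    _ = bump m t + bump (m + 1) t := Finset.sum_pair (by simp)
    _ ≤ 2 := by linarith [bump_le_one m t, bump_le_one (m + 1) t]

theorem eventually_two_le_two_pow_mul {t : ℝ} (ht : 0 < t) :
    ∀ᶠ n : ℕ in atTop, 2 ≤ 2 ^ n * t := by
  filter_upwards [(tendsto_pow_atTop_atTop_of_one_lt one_lt_two).eventually_ge_atTop (2 / t)]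
    with n hn
  rwa [div_le_iff₀ ht] at hn

/-- The squares telescope to `cutoff N t - cutoff 0 t`, and `t ≤ 1` kills the second term. -/
theorem tendsto_sum_bump_mul_self {t : ℝ} (ht : 0 < t) (ht1 : t ≤ 1) :
    Tendsto (fun N => ∑ n ∈ Finset.range N, bump n t * bump n t) atTop (𝓝 1) := by
  have h : ∀ N, ∑ n ∈ Finset.range N, bump n t * bump n t = cutoff N t := fun N => by
    rw [Finset.sum_congr rfl fun n _ => bump_mul_self n ht.le,
      Finset.sum_range_sub (fun n => cutoff n t), cutoff_of_le (n := 0) (by simpa using ht1),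
      sub_zero]
  refine tendsto_const_nhds.congr' ?_
  filter_upwards [eventually_two_le_two_pow_mul ht] with N hN
  rw [h, cutoff_of_ge hN]

end Cutoff

/-! ### Elements with strictly positive Gelfand transform. -/

section Positive

variable {A : Type u} [NonUnitalCommCStarAlgebra A]

/-- The Gelfand transform of `a` is strictly positive everywhere. -/
def IsPositiveOnCharacters (a : A) : Prop := ∀ χ : characterSpace ℂ A, 0 < χ a

variable {a : A}

theorem IsPositiveOnCharacters.re_pos (h : IsPositiveOnCharacters a) (χ : characterSpace ℂ A) :
    0 < (χ a).re := (Complex.pos_iff.1 (h χ)).1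

theorem IsPositiveOnCharacters.coe_re (h : IsPositiveOnCharacters a) (χ : characterSpace ℂ A) :
    ((χ a).re : ℂ) = χ a :=
  Complex.ext rfl (by simpa using (Complex.pos_iff.1 (h χ)).2)

theorem IsPositiveOnCharacters.isSelfAdjoint (h : IsPositiveOnCharacters a) : IsSelfAdjoint a :=
  eq_of_forall_character fun χ => by
    rw [character_map_star]
    exact (IsSelfAdjoint.of_nonneg (h χ).le).star_eq

theorem IsPositiveOnCharacters.character_cutoff (h : IsPositiveOnCharacters a) (n : ℕ)
    (χ : characterSpace ℂ A) : χ (cfcₙ (cutoff n) a) = cutoff n (χ a).re :=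
  character_cfcₙ χ (continuous_cutoff n) (cutoff_apply_zero n) h.isSelfAdjoint

theorem IsPositiveOnCharacters.character_bump (h : IsPositiveOnCharacters a) (n : ℕ)
    (χ : characterSpace ℂ A) : χ (cfcₙ (bump n) a) = bump n (χ a).re :=
  character_cfcₙ χ (continuous_bump n) (bump_apply_zero n) h.isSelfAdjoint

/-- The transform of `a` has a positive minimum on the compact set where `b` is not small. Hence for
large `n` the cutoffs are `1` and the bumps `0` there. -/
theorem IsPositiveOnCharacters.eventually_two_le (h : IsPositiveOnCharacters a) (b : A) {ε : ℝ}
    (hε : 0 < ε) : ∀ᶠ n : ℕ in atTop, ∀ χ : characterSpace ℂ A, ε ≤ ‖χ b‖ →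
      2 ≤ 2 ^ n * (χ a).re := by
  rcases {χ : characterSpace ℂ A | ε ≤ ‖χ b‖}.eq_empty_or_nonempty with he | hne
  · exact Eventually.of_forall fun n χ hχ =>
      (Set.notMem_empty χ (he.subset hχ)).elim
  · obtain ⟨χ₀, -, hmin⟩ := (isCompact_character_ge b hε).exists_isMinOn hne
      (Complex.continuous_re.comp (continuous_eval_character a)).continuousOn
    filter_upwards [eventually_two_le_two_pow_mul (h.re_pos χ₀)] with n hn χ hχ
    have : (χ₀ a).re ≤ (χ a).re := hmin hχ
    exact hn.trans (by gcongr)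

theorem IsPositiveOnCharacters.isSeqApproxIdentity (h : IsPositiveOnCharacters a) :
    IsSeqApproxIdentityBoundedByOne fun n => cfcₙ (cutoff n) a := by
  have key : ∀ b : A, Tendsto (fun n => cfcₙ (cutoff n) a * b) atTop (𝓝 b) := fun b => by
    rw [Metric.tendsto_atTop']
    intro ε hε
    obtain ⟨N, hN⟩ := eventually_atTop.1 (h.eventually_two_le b (half_pos hε))
    refine ⟨N, fun n hn => ?_⟩
    rw [dist_eq_norm]
    refine lt_of_le_of_lt (norm_le_of_forall_character (half_pos hε).le fun χ => ?_)
      (half_lt_self hε)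
    rw [map_sub, map_mul, h.character_cutoff]
    rcases le_or_gt (ε / 2) ‖χ b‖ with hb | hb
    · rw [cutoff_of_ge (hN n hn.le χ hb)]
      simpa using (half_pos hε).le
    · have h1 : (cutoff n (χ a).re : ℂ) * χ b - χ b = ((cutoff n (χ a).re - 1 : ℝ) : ℂ) * χ b := by
        push_cast; ring
      rw [h1, norm_mul, Complex.norm_real, Real.norm_eq_abs]
      have h2 : |cutoff n (χ a).re - 1| ≤ 1 := by
        rw [abs_le]
        constructor <;> linarith [cutoff_nonneg n (χ a).re, cutoff_le_one n (χ a).re]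
      exact (mul_le_of_le_one_left (norm_nonneg _) h2).trans hb.le
  refine ⟨fun n => norm_le_of_forall_character zero_le_one fun χ => ?_, ?_, ?_⟩
  · rw [h.character_cutoff, Complex.norm_real, Real.norm_eq_abs,
      abs_of_nonneg (cutoff_nonneg _ _)]
    exact cutoff_le_one _ _
  · intro b
    rw [tendsto_map'_iff]
    exact (key b).congr fun n => mul_comm _ _
  · intro b
    rw [tendsto_map'_iff]
    exact key b

/-- `B x₀ y₀ + B (x k) (y k)` is the mean of `B (x₀ ± x k) (y₀ ± y k)` over the two signs. The extra
pair `x₀`, `y₀` accumulates the signed sums through the induction, without spoiling the pointwise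
bounds. -/
theorem norm_add_sum_bilinear_le {Y : Type*} [NormedAddCommGroup Y] [NormedSpace ℂ Y] {ι : Type*}
    (B : A →L[ℂ] A →L[ℂ] Y) (x y : ι → A) {P Q : ℝ} (hP : 0 ≤ P) (hQ : 0 ≤ Q) (s : Finset ι) :
    ∀ x₀ y₀ : A, (∀ χ : characterSpace ℂ A, ‖χ x₀‖ + ∑ i ∈ s, ‖χ (x i)‖ ≤ P) →
      (∀ χ : characterSpace ℂ A, ‖χ y₀‖ + ∑ i ∈ s, ‖χ (y i)‖ ≤ Q) →
      ‖B x₀ y₀ + ∑ i ∈ s, B (x i) (y i)‖ ≤ ‖B‖ * P * Q := by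
  classical
  induction s using Finset.induction_on with
  | empty =>
    intro x₀ y₀ hx hy
    simp only [Finset.sum_empty, add_zero] at hx hy ⊢
    have h1 := norm_le_of_forall_character hP hx
    have h2 := norm_le_of_forall_character hQ hy
    exact (B.le_opNorm₂ x₀ y₀).trans (by gcongr)
  | insert k s hk ih =>
    intro x₀ y₀ hx hy
    simp only [Finset.sum_insert hk] at hx hy ⊢
    have h1 := ih (x₀ + x k) (y₀ + y k)
      (fun χ => by
        have := norm_add_le (χ x₀) (χ (x k))
        rw [map_add]; linarith [hx χ])
      (fun χ => by
        have := norm_add_le (χ y₀) (χ (y k))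
        rw [map_add]; linarith [hy χ])
    have h2 := ih (x₀ - x k) (y₀ - y k)
      (fun χ => by
        have := norm_sub_le (χ x₀) (χ (x k))
        rw [map_sub]; linarith [hx χ])
      (fun χ => by
        have := norm_sub_le (χ y₀) (χ (y k))
        rw [map_sub]; linarith [hy χ])
    have h3 : B x₀ y₀ + (B (x k) (y k) + ∑ i ∈ s, B (x i) (y i)) =
        (2⁻¹ : ℂ) • ((B (x₀ + x k) (y₀ + y k) + ∑ i ∈ s, B (x i) (y i)) +
          (B (x₀ - x k) (y₀ - y k) + ∑ i ∈ s, B (x i) (y i))) := by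
      rw [eq_inv_smul_iff₀ two_ne_zero, two_smul]
      simp only [map_add, map_sub, add_apply, sub_apply]
      abel
    have h4 : ‖(2⁻¹ : ℂ)‖ = 2⁻¹ := by simp
    rw [h3, norm_smul, h4]
    have h5 := norm_add_le (B (x₀ + x k) (y₀ + y k) + ∑ i ∈ s, B (x i) (y i))
      (B (x₀ - x k) (y₀ - y k) + ∑ i ∈ s, B (x i) (y i))
    linarith

/-- The norm of `∑ B (x i) (y i)` is controlled by the Gelfand transforms of `x` and `y`: average
over all choices of signs. -/
theorem norm_sum_bilinear_le {Y : Type*} [NormedAddCommGroup Y] [NormedSpace ℂ Y] {ι : Type*}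
    (B : A →L[ℂ] A →L[ℂ] Y) (x y : ι → A) {P Q : ℝ} (hP : 0 ≤ P) (hQ : 0 ≤ Q) (s : Finset ι)
    (hx : ∀ χ : characterSpace ℂ A, ∑ i ∈ s, ‖χ (x i)‖ ≤ P)
    (hy : ∀ χ : characterSpace ℂ A, ∑ i ∈ s, ‖χ (y i)‖ ≤ Q) :
    ‖∑ i ∈ s, B (x i) (y i)‖ ≤ ‖B‖ * P * Q := by
  simpa using norm_add_sum_bilinear_le B x y hP hQ s 0 0 (by simpa using hx) (by simpa using hy)

theorem IsPositiveOnCharacters.sum_norm_bump_le (h : IsPositiveOnCharacters a) (s : Finset ℕ)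
    (χ : characterSpace ℂ A) : ∑ n ∈ s, ‖χ (cfcₙ (bump n) a)‖ ≤ 2 := by
  simp only [h.character_bump, Complex.norm_real, Real.norm_eq_abs,
    abs_of_nonneg (bump_nonneg _ _)]
  exact sum_bump_le_two s (h.re_pos χ).le

theorem IsPositiveOnCharacters.norm_sum_bump_le (h : IsPositiveOnCharacters a) {Y : Type*}
    [NormedAddCommGroup Y] [NormedSpace ℂ Y] (B : A →L[ℂ] A →L[ℂ] Y) (b : A) (s : Finset ℕ) :
    ‖∑ n ∈ s, B (b * cfcₙ (bump n) a) (cfcₙ (bump n) a)‖ ≤ 4 * ‖B‖ * ‖b‖ := by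
  refine (norm_sum_bilinear_le B _ _ (P := ‖b‖ * 2) (Q := 2) (by positivity) zero_le_two s
    (fun χ => ?_) (h.sum_norm_bump_le s)).trans_eq (by ring)
  simp only [map_mul, norm_mul]
  rw [← Finset.mul_sum]
  exact mul_le_mul (norm_character_le χ b) (h.sum_norm_bump_le s χ)
    (Finset.sum_nonneg fun _ _ => norm_nonneg _) (norm_nonneg _)

theorem IsPositiveOnCharacters.summable_bump (h : IsPositiveOnCharacters a) {Y : Type*}
    [NormedAddCommGroup Y] [NormedSpace ℂ Y] [CompleteSpace Y] (B : A →L[ℂ] A →L[ℂ] Y) (b : A) :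
    Summable fun n => B (b * cfcₙ (bump n) a) (cfcₙ (bump n) a) := by
  rw [summable_iff_vanishing_norm]
  intro ε hε
  have hB : 0 < ‖B‖ + 1 := by positivity
  -- The bilinear bound for the tail is `4 * ‖B‖ * η`; adding `1` to `‖B‖` makes it less than `ε`
  -- and covers `B = 0`.
  set η : ℝ := ε / (4 * (‖B‖ + 1)) with hη
  have hη0 : 0 < η := by positivity
  obtain ⟨N, hN⟩ := eventually_atTop.1 (h.eventually_two_le b hη0)
  refine ⟨Finset.range N, fun s hs => ?_⟩
  have hsN : ∀ n ∈ s, N ≤ n := fun n hn => by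
    by_contra! hlt
    exact Finset.disjoint_left.1 hs hn (Finset.mem_range.2 hlt)
  have hbound := norm_sum_bilinear_le B (fun n => b * cfcₙ (bump n) a)
    (fun n => cfcₙ (bump n) a) (P := η * 2) (Q := 2) (by positivity) zero_le_two s
    (fun χ => ?_) (h.sum_norm_bump_le s)
  · refine hbound.trans_lt ?_
    have : (‖B‖ + 1) * (η * 2) * 2 = ε := by
      rw [hη]; field_simp; norm_num
    nlinarith
  · simp only [map_mul, norm_mul]
    rw [← Finset.mul_sum]
    rcases le_or_gt η ‖χ b‖ with hb | hb
    · have h0 : ∑ n ∈ s, ‖χ (cfcₙ (bump n) a)‖ = 0 := Finset.sum_eq_zero fun n hn => by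
        rw [h.character_bump, bump_of_ge (hN n (hsN n hn) χ hb)]
        simp
      rw [h0, mul_zero]
      positivity
    · exact mul_le_mul hb.le (h.sum_norm_bump_le s χ)
        (Finset.sum_nonneg fun _ _ => norm_nonneg _) hη0.le

/-- With `w n` the bumps of `a`, the splitting is `b ↦ ∑ (b * w n) · σ (w n)`. Applying `φ` gives `∑
b * w n * w n`, which equals `b` at every character because `‖a‖ ≤ 1`. -/
theorem IsPositiveOnCharacters.isLeftProjective (h : IsPositiveOnCharacters a) (ha1 : ‖a‖ ≤ 1) :
    IsLeftProjective A := by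
  intro Y _ _ _ αY φ hφ ⟨σ, hσ⟩
  have hφσ : ∀ a, φ (σ a) = a := fun a => DFunLike.congr_fun hσ a
  let B : A →L[ℂ] A →L[ℂ] Y := ((ContinuousLinearMap.compL ℂ A Y Y).flip σ).comp αY.act
  have hB : ∀ x y, B x y = αY.act x (σ y) := fun x y => rfl
  have hsum := fun b => (h.summable_bump B b).hasSum
  let ψ : A →L[ℂ] Y := LinearMap.mkContinuous
    { toFun := fun b => ∑' n, B (b * cfcₙ (bump n) a) (cfcₙ (bump n) a)
      map_add' := fun b c => by
        refine HasSum.tsum_eq (((hsum b).add (hsum c)).congr_fun fun n => ?_)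
        simp [add_mul]
      map_smul' := fun r b => by
        refine HasSum.tsum_eq (((hsum b).const_smul r).congr_fun fun n => ?_)
        rw [smul_mul_assoc, map_smul]
        rfl } (4 * ‖B‖)
    fun b => le_of_tendsto (hsum b).norm (Eventually.of_forall (h.norm_sum_bump_le B b))
  have hψ : ∀ b, HasSum (fun n => B (b * cfcₙ (bump n) a) (cfcₙ (bump n) a)) (ψ b) := hsum
  refine ⟨ψ, fun c b => ?_, ?_⟩
  · refine (hψ (c * b)).unique (((αY.act c).hasSum (hψ b)).congr_fun fun n => ?_)
    simp only [hB, mul_assoc, αY.mul_act]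
  · ext b
    refine eq_of_forall_character fun χ => ?_
    have h1 : HasSum (fun n => χ b * ((bump n (χ a).re * bump n (χ a).re : ℝ) : ℂ))
        (χ (φ (ψ b))) := by
      refine ((CharacterSpace.toCLM χ).hasSum (φ.hasSum (hψ b))).congr_fun fun n => ?_
      have h2 : φ (B (b * cfcₙ (bump n) a) (cfcₙ (bump n) a)) =
          b * cfcₙ (bump n) a * cfcₙ (bump n) a := by
        rw [hB, hφ, hφσ]; rfl
      simp only [h2, CharacterSpace.coe_toCLM, map_mul, h.character_bump]
      push_cast
      ring
    have hle : (χ a).re ≤ 1 :=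
      (Complex.re_le_norm _).trans ((norm_character_le χ a).trans ha1)
    have h3 : Tendsto (fun N => ∑ n ∈ Finset.range N,
        χ b * ((bump n (χ a).re * bump n (χ a).re : ℝ) : ℂ)) atTop (𝓝 (χ b * ((1 : ℝ) : ℂ))) := by
      simp only [← Finset.mul_sum, ← Complex.ofReal_sum]
      exact tendsto_const_nhds.mul
        ((Complex.continuous_ofReal.tendsto _).comp (tendsto_sum_bump_mul_self (h.re_pos χ) hle))
    have h4 := tendsto_nhds_unique h1.tendsto_sum_nat h3
    rw [Complex.ofReal_one, mul_one] at h4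
    exact h4

theorem IsPositiveOnCharacters.exists_norm_le_one (h : IsPositiveOnCharacters a) :
    ∃ b : A, IsPositiveOnCharacters b ∧ ‖b‖ ≤ 1 := by
  have hpos : 0 < 1 + ‖a‖ := by positivity
  refine ⟨(((1 + ‖a‖)⁻¹ : ℝ) : ℂ) • a, fun χ => ?_, ?_⟩
  · rw [map_smul, smul_eq_mul]
    exact mul_pos (by exact_mod_cast inv_pos.2 hpos) (h χ)
  · rw [norm_smul, Complex.norm_real, norm_inv, Real.norm_of_nonneg hpos.le, inv_mul_le_iff₀ hpos]
    linarith

theorem IsPositiveOnCharacters.sigmaCompactSpace (h : IsPositiveOnCharacters a) :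
    SigmaCompactSpace (characterSpace ℂ A) := by
  refine SigmaCompactSpace.of_countable
    (Set.range fun n : ℕ => {χ : characterSpace ℂ A | 1 / ((n : ℝ) + 1) ≤ ‖χ a‖})
    (Set.countable_range _) ?_ ?_
  · rintro _ ⟨n, rfl⟩
    exact isCompact_character_ge a (by positivity)
  · refine Set.eq_univ_of_forall fun χ => ?_
    obtain ⟨n, hn⟩ := exists_nat_one_div_lt (norm_pos_iff.2 (h χ).ne')
    exact ⟨_, ⟨n, rfl⟩, hn.le⟩

/-- At each character the values of `e n` tend to `1`, so some value exceeds `1 / 2` in modulus. -/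
theorem sigmaCompactSpace_of_isSeqApproxIdentity {e : ℕ → A}
    (he : IsSeqApproxIdentityBoundedByOne e) : SigmaCompactSpace (characterSpace ℂ A) := by
  refine SigmaCompactSpace.of_countable
    (Set.range fun n : ℕ => {χ : characterSpace ℂ A | 1 / 2 ≤ ‖χ (e n)‖})
    (Set.countable_range _) ?_ ?_
  · rintro _ ⟨n, rfl⟩
    exact isCompact_character_ge (e n) one_half_pos
  · refine Set.eq_univ_of_forall fun χ => ?_
    obtain ⟨b, hb⟩ := exists_character_ne_zero χ
    have h1 := (map_continuous χ).tendsto b |>.comp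
      (tendsto_map'_iff.1 (he.2.tendsto_mul_right b))
    have h2 : Tendsto (fun n => ‖χ (e n) * χ b‖) atTop (𝓝 ‖χ b‖) :=
      h1.norm.congr fun n => by simp
    obtain ⟨n, hn⟩ := (h2.eventually (lt_mem_nhds (half_lt_self (norm_pos_iff.2 hb)))).exists
    refine ⟨_, ⟨n, rfl⟩, ?_⟩
    change 1 / 2 ≤ ‖χ (e n)‖
    rw [norm_mul, div_eq_mul_one_div, mul_comm] at hn
    exact (lt_of_mul_lt_mul_right hn (norm_nonneg _)).le

theorem exists_pos_on_isCompact {K : Set (characterSpace ℂ A)} (hK : IsCompact K) :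
    ∃ a : A, (∀ χ : characterSpace ℂ A, 0 ≤ χ a) ∧ ∀ χ ∈ K, 0 < χ a := by
  refine hK.induction_on (p := fun K : Set (characterSpace ℂ A) =>
    ∃ a : A, (∀ χ : characterSpace ℂ A, 0 ≤ χ a) ∧ ∀ χ ∈ K, 0 < χ a) ?_ ?_ ?_ ?_
  · exact ⟨0, fun χ => by simp, fun χ hχ => hχ.elim⟩
  · rintro s t hst ⟨a, ha, hat⟩
    exact ⟨a, ha, fun χ hχ => hat χ (hst hχ)⟩
  · rintro s t ⟨a, ha, has⟩ ⟨b, hb, hbt⟩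
    refine ⟨a + b, fun χ => by rw [map_add]; exact add_nonneg (ha χ) (hb χ), ?_⟩
    rintro χ (hχ | hχ) <;> rw [map_add]
    · exact add_pos_of_pos_of_nonneg (has χ hχ) (hb χ)
    · exact add_pos_of_nonneg_of_pos (ha χ) (hbt χ hχ)
  · intro χ _
    obtain ⟨b, hb⟩ := exists_character_ne_zero χ
    have heq : ∀ s : characterSpace ℂ A, s (star b * b) = star (s b) * s b := fun s => by
      rw [map_mul, character_map_star]
    refine ⟨{s | s b ≠ 0}, mem_nhdsWithin_of_mem_nhds
      ((continuous_eval_character b).continuousAt.eventually_ne hb), star b * b, fun s => ?_,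
      fun s hs => ?_⟩
    · rw [heq]; exact star_mul_self_nonneg _
    · rw [heq]
      exact lt_of_le_of_ne (star_mul_self_nonneg _)
        (mul_ne_zero (star_ne_zero.2 hs) hs).symm

theorem exists_isPositiveOnCharacters [SigmaCompactSpace (characterSpace ℂ A)] :
    ∃ a : A, IsPositiveOnCharacters a := by
  choose a ha0 haK using fun n => exists_pos_on_isCompact
    (isCompact_compactCovering (characterSpace ℂ A) n)
  -- These positive weights make the series of the `a n` converge in norm; the `1 +` avoids
  -- inverting zero.
  let r : ℕ → ℝ := fun n => (1 / 2) ^ n * (1 + ‖a n‖)⁻¹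
  have hr : ∀ n, 0 < r n := fun n => by positivity
  have hs : Summable fun n => (r n : ℂ) • a n := by
    refine Summable.of_norm_bounded summable_geometric_two fun n => ?_
    rw [norm_smul, Complex.norm_real, Real.norm_of_nonneg (hr n).le]
    have : (1 + ‖a n‖)⁻¹ * ‖a n‖ ≤ 1 := by
      rw [inv_mul_le_iff₀ (by positivity)]
      linarith
    calc (1 / 2) ^ n * (1 + ‖a n‖)⁻¹ * ‖a n‖ = (1 / 2) ^ n * ((1 + ‖a n‖)⁻¹ * ‖a n‖) := by ring
      _ ≤ (1 / 2) ^ n := mul_le_of_le_one_right (by positivity) this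
  refine ⟨∑' n, (r n : ℂ) • a n, fun χ => ?_⟩
  have h1 : HasSum (fun n => (r n : ℂ) * χ (a n)) (χ (∑' n, (r n : ℂ) • a n)) :=
    ((CharacterSpace.toCLM χ).hasSum hs.hasSum).congr_fun fun n => by simp
  obtain ⟨n, hn⟩ := Set.mem_iUnion.1
    ((iUnion_compactCovering (characterSpace ℂ A)).symm ▸ Set.mem_univ χ :
      χ ∈ ⋃ n, compactCovering (characterSpace ℂ A) n)
  have hr' : ∀ m, (0 : ℂ) < r m := fun m => by exact_mod_cast hr m
  exact (mul_pos (hr' n) (haK n χ hn)).trans_le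
    (le_hasSum h1 n fun m _ => mul_nonneg (hr' m).le (ha0 m χ))

variable [PartialOrder A] [StarOrderedRing A]

theorem StrictlyPositiveElement.isPositiveOnCharacters (h : StrictlyPositiveElement a) :
    IsPositiveOnCharacters a := fun χ => h.2 (characterPositive χ) fun h0 => by
  obtain ⟨b, hb⟩ := exists_character_ne_zero χ
  exact hb (DFunLike.congr_fun h0 b)

/-- Suppose `f a = 0`. For `b ≥ 0`, the product of the `n`-th cutoff of `a` with `b` lies between
`0` and `2 ^ n * ‖b‖` times `a`, so `f` kills it. In the limit `f b = 0`, and positive elements span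
`A`. -/
theorem IsPositiveOnCharacters.strictlyPositiveElement (h : IsPositiveOnCharacters a) :
    StrictlyPositiveElement a := by
  have ha : 0 ≤ a := nonneg_of_forall_character fun χ => (h χ).le
  refine ⟨ha, fun f hf => lt_of_le_of_ne (f.map_nonneg ha) fun h0 => hf ?_⟩
  have hpos : ∀ b : A, 0 ≤ b → f b = 0 := fun b hb => by
    have hn : ∀ n, f (cfcₙ (cutoff n) a * b) = 0 := fun n => by
      have h1 : 0 ≤ cfcₙ (cutoff n) a * b := nonneg_of_forall_character fun χ => by
        rw [map_mul, h.character_cutoff]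
        exact mul_nonneg (by exact_mod_cast cutoff_nonneg _ _) (character_nonneg χ hb)
      have h2 : cfcₙ (cutoff n) a * b ≤ ((2 ^ n * ‖b‖ : ℝ) : ℂ) • a := by
        rw [← sub_nonneg]
        refine nonneg_of_forall_character fun χ => ?_
        have hc := Complex.nonneg_iff.1 (character_nonneg χ hb)
        have hb' : χ b = ((χ b).re : ℂ) := Complex.ext rfl (by simpa using hc.2.symm)
        rw [map_sub, map_mul, map_smul, h.character_cutoff, smul_eq_mul, ← h.coe_re χ, hb',
          sub_nonneg, ← Complex.ofReal_mul, ← Complex.ofReal_mul, Complex.real_le_real,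
          Complex.ofReal_re]
        have h3 : (χ b).re ≤ ‖b‖ := (Complex.re_le_norm _).trans (norm_character_le χ b)
        calc cutoff n (χ a).re * (χ b).re ≤ (2 ^ n * (χ a).re) * ‖b‖ :=
              mul_le_mul (cutoff_le_mul n (h.re_pos χ).le) h3 hc.1
                (mul_nonneg (by positivity) (h.re_pos χ).le)
          _ = 2 ^ n * ‖b‖ * (χ a).re := by ring
      refine le_antisymm ?_ (f.map_nonneg h1)
      have h4 := f.monotone' h2
      change f _ ≤ f _ at h4
      rwa [map_smul, ← h0, smul_zero] at h4
    have hlim := ((map_continuous f).tendsto b).comp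
      (tendsto_map'_iff.1 (h.isSeqApproxIdentity.2.tendsto_mul_right b))
    exact (tendsto_nhds_unique hlim (tendsto_const_nhds.congr fun n => (hn n).symm))
  ext x
  have hx : x ∈ Submodule.span ℂ {b : A | 0 ≤ b} := by
    rw [CStarAlgebra.span_nonneg]; trivial
  induction hx using Submodule.span_induction with
  | mem b hb => exact hpos b hb
  | zero => exact map_zero f
  | add x y _ _ hx hy => rw [map_add, hx, hy]; simp
  | smul c x _ hx => rw [map_smul, hx]; simp

end Positive

end BanachHomology

open BanachHomology in
theorem theorem6p2 {A : Type u} [NonUnitalCommCStarAlgebra A] [PartialOrder A] [StarOrderedRing A]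
    (hA : SuslinCondition (WeakDual.characterSpace ℂ A)) :
    List.TFAE
      [IsLeftProjective A,
       ParacompactSpace (WeakDual.characterSpace ℂ A),
       ∃ a : A, StrictlyPositiveElement a,
       SigmaCompactSpace (WeakDual.characterSpace ℂ A),
       LindelofSpace (WeakDual.characterSpace ℂ A),
       ∃ e : ℕ → A, IsSeqApproxIdentityBoundedByOne e,
       ∀ (X : Type u) [NormedAddCommGroup X] [NormedSpace ℂ X] [CompleteSpace X]
         (β : BiAction A X), β.IsRightAnnihilator → Subsingleton β.H2] := by
  tfae_have 1 → 4 := hA.sigmaCompactSpace_of_isLeftProjective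
  tfae_have 4 → 1 := fun _ => by
    obtain ⟨a, ha⟩ := exists_isPositiveOnCharacters (A := A)
    obtain ⟨b, hb, hb1⟩ := ha.exists_norm_le_one
    exact hb.isLeftProjective hb1
  tfae_have 2 → 4 := fun _ => hA.sigmaCompactSpace_of_paracompactSpace
  tfae_have 4 → 2 := fun _ => inferInstance
  tfae_have 3 → 4 := fun ⟨_, ha⟩ => ha.isPositiveOnCharacters.sigmaCompactSpace
  tfae_have 4 → 3 := fun _ =>
    let ⟨a, ha⟩ := exists_isPositiveOnCharacters (A := A)
    ⟨a, ha.strictlyPositiveElement⟩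
  tfae_have 5 → 4 := fun _ => sigmaCompactSpace_of_lindelofSpace
  tfae_have 4 → 5 := fun _ => inferInstance
  tfae_have 6 → 4 := fun ⟨_, he⟩ => sigmaCompactSpace_of_isSeqApproxIdentity he
  tfae_have 4 → 6 := fun _ =>
    let ⟨_, ha⟩ := exists_isPositiveOnCharacters (A := A)
    ⟨_, ha.isSeqApproxIdentity⟩
  tfae_have 1 → 7 := subsingleton_H2_of_isLeftProjective
  tfae_have 7 → 1 := isLeftProjective_of_subsingleton_H2
  tfae_finish
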